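/- All posets are finite. Let $\mathcal{A}$ and $\mathcal{S}$ be finite posets. *Monotonicity equivalence.* For probability measures $P,P'$ on $\mathcal{S}$ write $P\preceq P'$ if $P(U)\le P'(U)$ for every up-set $U$ of $\mathcal{S}$. A system $(P_\gamma:\gamma\in\mathcal{A})$ of probability measures on $\mathcal{S}$ is *stochastically monotone* if $P_\alpha\preceq P_\beta$ whenever $\alpha<\beta$ in $\mathcal{A}$. It is *realizably monotone* if there are $\mathcal{S}$-valued random variables $X_\gamma$ ($\gamma\in\mathcal{A}$) on a common probability space such that $X_\gamma$ has distribution $P_\gamma$ for each $\gamma$, and $X_\alpha\le X_\beta$ whenever $\alpha<\beta$. *Monotonicity equivalence* holds for $(\mathcal{A},\mathcal{S})$ if every system of probability measures on $\mathcal{S}$ indexed by $\mathcal{A}$ is stochastically monotone if and only if it is realizably monotone. *Class W.* $\mathcal{S}$ is of *Class W* if its Hasse diagram, viewed as an undirected graph, is a tree and $\mathcal{S}$ has no induced Y-poset, that is, there are no elements $x,y,z,w$ with $x,y$ incomparable and either $x,y<z<w$ or $w<z<x,y$. A poset of Class W is in *Class* $\mathrm{W}_\star$ if no element lies below three pairwise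 incomparable elements, and in *Class* $\mathrm{W}^\star$ if no element lies above three pairwise incomparable elements. *Synchronizability.* Let $D$ be the set of minimal elements of $\mathcal{A}$, and let $G$ be the graph on $D$ in which distinct $\beta,\beta'$ are adjacent if and only if $\beta,\beta'<\alpha$ for some $\alpha\in\mathcal{A}$. A spanning tree $T$ of $G$ is *locally connected* if for every $\alpha\in\mathcal{A}$ the subgraph of $T$ induced on $\{\beta\in D:\beta\le\alpha\}$ is connected. $\mathcal{A}$ is *synchronizable for Class* $\mathrm{W}_\star$ if $G$ has a locally connected spanning tree; it is *synchronizable for Class* $\mathrm{W}^\star$ if the dual poset of $\mathcal{A}$ is synchronizable for Class $\mathrm{W}_\star$; and it is *synchronizable* if it is both. **Theorem.** Let $\mathcal{S}$ be a poset of Class W. Each of the following conditions guarantees monotonicity equivalence for $(\mathcal{A},\mathcal{S})$: (i) $\mathcal{A}$ is synchronizable; (ii) $\mathcal{S}$ is in Class $\mathrm{W}_\star$ and $\mathcal{A}$ is synchronizable for Class $\mathrm{W}_\star$; (iii) $\mathcal{S}$ is in Class $\mathrm{W}^\star$ and $\mathcal{A}$ is synchronizable for Class $\mathrm{W}^\star$.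 -/

import Mathlib

open MeasureTheory

namespace MonEquiv

universe u v

/-! ### Posets of Class W -/

/-- `S` contains an induced Y-poset: four elements `x, y, z, w` with `x` and `y` incomparable and
either `x, y < z < w` or, upside down, `w < z < x, y`. -/
def HasY (S : Type v) [PartialOrder S] : Prop :=
  ∃ x y z w : S, IncompRel (· ≤ ·) x y ∧
    ((x < z ∧ y < z ∧ z < w) ∨ (w < z ∧ z < x ∧ z < y))

/-- `S` contains an induced `W^⋆`-poset: an element `w` below three pairwise incomparable
elements. -/
def HasWUpper (S : Type v) [PartialOrder S] : Prop :=
  ∃ w x y z : S, w < x ∧ w < y ∧ w < z ∧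
    IncompRel (· ≤ ·) x y ∧ IncompRel (· ≤ ·) y z ∧ IncompRel (· ≤ ·) x z

/-- `S` contains an induced `W_⋆`-poset: an element `w` above three pairwise incomparable
elements. -/
def HasWLower (S : Type v) [PartialOrder S] : Prop :=
  ∃ w x y z : S, x < w ∧ y < w ∧ z < w ∧
    IncompRel (· ≤ ·) x y ∧ IncompRel (· ≤ ·) y z ∧ IncompRel (· ≤ ·) x z

/-- Class W: the (undirected) Hasse diagram is a tree, and there is no induced Y-poset. -/
structure IsClassW (S : Type v) [PartialOrder S] : Prop where
  isTree : (SimpleGraph.hasse S).IsTree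
  not_hasY : ¬ HasY S

/-- Class `W_⋆`: Class W, and the only posets of type `W_⋆` or `W^⋆` that it may contain as induced
subposets are `W_⋆`-posets. -/
structure IsClassWLower (S : Type v) [PartialOrder S] : Prop extends IsClassW S where
  not_hasWUpper : ¬ HasWUpper S

/-- Class `W^⋆`: Class W, and the only posets of type `W_⋆` or `W^⋆` that it may contain as induced
subposets are `W^⋆`-posets. -/
structure IsClassWUpper (S : Type v) [PartialOrder S] : Prop extends IsClassW S where
  not_hasWLower : ¬ HasWLower S

/-! ### Synchronizable posets -/

/-- The graph of interlaced relation on the minimal elements of `A`: two distinct minimal elements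
are adjacent when they lie strictly below a common element. -/
def interlacedGraph (A : Type u) [PartialOrder A] : SimpleGraph {b : A // IsMin b} where
  Adj b b' := b ≠ b' ∧ ∃ a : A, b.1 < a ∧ b'.1 < a
  symm := ⟨fun _ _ h => ⟨h.1.symm, h.2.imp fun _ ha => ⟨ha.2, ha.1⟩⟩⟩
  loopless := ⟨fun _ h => h.1 rfl⟩

/-- `T` is a locally connected spanning tree of the graph of interlaced relation: for each `a` the
subgraph of `T` induced on the set of minimal elements `b ≤ a` is connected. -/
structure IsLocallyConnectedSpanningTree {A : Type u} [PartialOrder A]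
    (T : SimpleGraph {b : A // IsMin b}) : Prop where
  le_interlacedGraph : T ≤ interlacedGraph A
  isTree : T.IsTree
  locallyConnected : ∀ a : A, (T.induce {b : {b : A // IsMin b} | b.1 ≤ a}).Connected

/-- `A` is synchronizable for Class `W_⋆`. -/
def SynchronizableLower (A : Type u) [PartialOrder A] : Prop :=
  ∃ T : SimpleGraph {b : A // IsMin b}, IsLocallyConnectedSpanningTree T

/-- `A` is synchronizable for Class `W^⋆`: the dual notion, on the maximal elements of `A`. -/
def SynchronizableUpper (A : Type u) [PartialOrder A] : Prop :=
  SynchronizableLower Aᵒᵈ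

/-- `A` is synchronizable: it is so for both Class `W_⋆` and Class `W^⋆`. -/
def Synchronizable (A : Type u) [PartialOrder A] : Prop :=
  SynchronizableLower A ∧ SynchronizableUpper A

/-! ### Monotonicity of systems of probability measures -/

section Monotonicity

variable {A : Type u} {S : Type v} [PartialOrder A] [PartialOrder S] [MeasurableSpace S]

/-- Stochastic ordering of measures on `S`: `P U ≤ P' U` for every up-set `U`. -/
def StochLE (P P' : Measure S) : Prop :=
  ∀ U : Set S, IsUpperSet U → P U ≤ P' U

/-- The system `(P a : a ∈ A)` is stochastically monotone. -/
def StochasticallyMonotone (P : A → Measure S) : Prop :=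
  ∀ a b : A, a < b → StochLE (P a) (P b)

/-- The system `(P a : a ∈ A)` is realizably monotone: there are `S`-valued random variables `X a`
on a common probability space, with `X a` distributed as `P a`, such that `X a ≤ X b` whenever
`a < b`. -/
def RealizablyMonotone (P : A → Measure S) : Prop :=
  ∃ (Ω : Type) (_ : MeasurableSpace Ω) (ℙ : Measure Ω) (X : A → Ω → S),
    IsProbabilityMeasure ℙ ∧
    (∀ a, Measurable (X a) ∧ ℙ.map (X a) = P a) ∧
    ∀ a b : A, a < b → ∀ ω, X a ω ≤ X b ω

end Monotonicity

/-- Monotonicity equivalence holds for `(A, S)`: a system of probability measures on `S` indexed by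
`A` is stochastically monotone if and only if it is realizably monotone. -/
def MonotonicityEquivalence (A : Type u) (S : Type v) [PartialOrder A] [PartialOrder S]
    [MeasurableSpace S] : Prop :=
  ∀ P : A → Measure S, (∀ a, IsProbabilityMeasure (P a)) →
    (StochasticallyMonotone P ↔ RealizablyMonotone P)

end MonEquiv

/-! ### Distances and retractions in trees -/

namespace SimpleGraph

variable {V : Type*} {G : SimpleGraph V}

/-! The system is mapped to simpler posets, realized there, and reassembled. For a minimal `m` of
`S`, sending each point to the nearest point of the up-set of `m` in the Hasse tree (its gate) is a
monotone retraction. Taken together over all `m`, the retractions hit `x` as often as the identity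
does, plus a surplus `#{m ≤ x} - 1` that does not depend on the point mapped. Without Y-posets this
surplus vanishes unless `x` is maximal (`IsClassW.exists_retraction`).

Adding realizations of the image systems therefore gives a weight `N` on monotone functions whose
marginals are wrong only at maximal points. Fix a minimal `b` of `A`. A function in the support of
`N` with maximal value at `b` is constant above `b`; replacing such functions by constant ones of
the correct weight repairs all marginals above `b`. The repaired weights of two minimal elements
with a common upper bound agree on the overlap of their up-sets, and local connectedness of the
spanning tree allows them to be glued by conditional independence (`exists_glue_tree`,
`Realizable.of_retractions`).

There remains the up-set of `m`, a bunch of chains issuing from `m`. For at most two chains one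
uniform variable suffices: the inverse probability transform, with the chains laid out on opposite
sides of `m`. For more chains the retraction argument is used dually: the poset is retracted onto
each maximal chain, and the surplus sits at `m`, which is maximal in the dual. -/

lemma Connected.exists_adj_dist_lt (hG : G.Connected) {x s : V} (h : x ≠ s) :
    ∃ c, G.Adj x c ∧ G.dist c s < G.dist x s := by
  obtain ⟨p, hp⟩ := hG.exists_walk_length_eq_dist x s
  cases p with
  | nil => exact absurd rfl h
  | cons hxc q =>
    refine ⟨_, hxc, ?_⟩
    have := dist_le q
    rw [Walk.length_cons] at hp
    omega

/-- A neighbour closer to `s` is the second vertex of a geodesic from `x` to `s`, and a tree has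
only one path between them. -/
lemma IsTree.eq_of_dist_lt (hG : G.IsTree) {x c c' s : V} (hc : G.Adj x c) (hc' : G.Adj x c')
    (h : G.dist c s < G.dist x s) (h' : G.dist c' s < G.dist x s) : c = c' := by
  have key : ∀ d, ∀ hd : G.Adj x d, G.dist d s < G.dist x s →
      ∃ p : G.Walk x s, p.IsPath ∧ p.snd = d := by
    intro d hd hlt
    obtain ⟨q, hq⟩ := hG.1.exists_walk_length_eq_dist d s
    refine ⟨.cons hd q, Walk.isPath_of_length_eq_dist _ ?_, by simp⟩
    have := dist_le (Walk.cons hd q)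
    rw [Walk.length_cons] at *
    omega
  obtain ⟨p, hp, rfl⟩ := key c hc h
  obtain ⟨q, hq, rfl⟩ := key c' hc' h'
  rw [(hG.existsUnique_path x s).unique hp hq]

/-- Only the edge itself joins the two sides of an edge of a tree. -/
lemma IsTree.eq_and_eq_of_dist_lt (hG : G.IsTree) {x c s s' : V} (hc : G.Adj x c)
    (hs : G.Adj s s') (h : G.dist x s < G.dist c s) (h' : G.dist c s' < G.dist x s') :
    s = x ∧ s' = c := by
  have key : ∀ {x c s s' : V}, G.Adj x c → G.Adj s s' → G.dist x s < G.dist c s →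
      G.dist c s' < G.dist x s' → s' = c := by
    intro x c s s' hc hs h h'
    by_contra hne
    have e1 := hG.dist_eq_dist_add_one_of_adj s hc
    have e2 := hG.dist_eq_dist_add_one_of_adj s' hc
    have e3 := hG.dist_eq_dist_add_one_of_adj x hs
    have e4 := hG.dist_eq_dist_add_one_of_adj c hs
    simp only [G.dist_comm (u := s), G.dist_comm (u := s')] at e1 e2
    simp only [G.dist_comm (u := x), G.dist_comm (u := c)] at e1 e2 e3 e4 h h'
    -- The neighbour `t` of `s'` towards `c` is also closer to `x` than `s'` is, and so is `s`.
    -- Hence `t = s`, although `s` is farther from `c` than `s'` is.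
    obtain ⟨t, ht, hlt⟩ := hG.1.exists_adj_dist_lt hne
    have e5 := hG.dist_eq_dist_add_one_of_adj c ht
    have e6 := hG.dist_eq_dist_add_one_of_adj x ht
    have e7 := hG.dist_eq_dist_add_one_of_adj t hc
    simp only [G.dist_comm (u := x), G.dist_comm (u := c)] at e5 e6
    have := hG.eq_of_dist_lt (s := x) hs.symm ht (by omega) (by omega)
    subst this
    omega
  exact ⟨key hc.symm hs.symm h' h, key hc hs h h'⟩

/-- `x` is a point of `K` at which the distance to `s` is locally minimal on `K`. -/
def IsGate (G : SimpleGraph V) (K : Set V) (s x : V) : Prop :=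
  x ∈ K ∧ ∀ c ∈ K, G.Adj x c → G.dist x s < G.dist c s

/-- Once a path in a tree moves away from `s` it keeps doing so: at a turning point two distinct
neighbours would both be closer to `s`. -/
lemma IsTree.dist_snd_lt_penultimate (hG : G.IsTree) {s : V} {x y : V} (p : G.Walk x y)
    (hp : p.IsPath) (hxy : x ≠ y) (h : G.dist x s < G.dist p.snd s) :
    G.dist p.penultimate s < G.dist y s := by
  induction p with
  | nil => exact absurd rfl hxy
  | @cons u v w huv q ih =>
    cases q with
    | nil => simpa using h
    | @cons _ z _ hvz q =>
      rw [Walk.penultimate_cons_cons]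
      have hp' := hp
      rw [Walk.cons_isPath_iff] at hp
      refine ih hp.1 ?_ ?_
      · rintro rfl
        have := hp.1
        rw [Walk.cons_isPath_iff] at this
        exact this.2 (Walk.end_mem_support _)
      · rw [Walk.snd_cons]
        rw [Walk.snd_cons] at h
        by_contra hlt
        have e := hG.dist_eq_dist_add_one_of_adj s hvz
        simp only [G.dist_comm (u := s)] at e
        have := hG.eq_of_dist_lt huv.symm hvz h (by omega)
        subst this
        exact hp.2 (by simp)

lemma Preconnected.exists_isPath_support_subset {K : Set V} (hK : (G.induce K).Preconnected)
    {x y : V} (hx : x ∈ K) (hy : y ∈ K) :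
    ∃ p : G.Walk x y, p.IsPath ∧ ∀ z ∈ p.support, z ∈ K := by
  classical
  obtain ⟨p⟩ := hK ⟨x, hx⟩ ⟨y, hy⟩
  refine ⟨p.toPath.1.map (Embedding.induce K).toHom, p.toPath.2.map Subtype.val_injective, ?_⟩
  intro z hz
  obtain ⟨a, -, rfl⟩ := List.mem_map.1 ((Walk.support_map _ _) ▸ hz)
  exact a.2

/-- A path inside `K` from one gate to another would move away from `s` at its first step, hence
also at its last, against local minimality at the end. -/
lemma IsTree.isGate_unique (hG : G.IsTree) {K : Set V} (hK : (G.induce K).Preconnected)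
    {s x y : V} (hx : G.IsGate K s x) (hy : G.IsGate K s y) : x = y := by
  by_contra hne
  have hxK : x ∈ K := hx.1
  have hyK : y ∈ K := hy.1
  obtain ⟨p, hp⟩ := hK.exists_isPath_support_subset hxK hyK
  have hnil : ¬ p.Nil := Walk.not_nil_of_ne hne
  have h1 := hx.2 _ (hp.2 _ (Walk.getVert_mem_support _ _)) (p.adj_snd hnil)
  have h2 := hG.dist_snd_lt_penultimate p hp.1 hne h1
  have h3 := hy.2 _ (hp.2 _ (Walk.getVert_mem_support _ _)) (p.adj_penultimate hnil).symm
  exact lt_asymm h2 h3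

lemma IsTree.exists_isGate (hG : G.IsTree) {K : Set V} (hK : K.Nonempty) (s : V) :
    ∃ x, G.IsGate K s x := by
  refine ⟨Function.argminOn (G.dist · s) K hK, Function.argminOn_mem _ _ _, fun c hc hadj => ?_⟩
  have h1 := Function.argminOn_le (G.dist · s) K hc
  have h2 := hG.dist_ne_of_adj s hadj
  simp only [G.dist_comm (u := s)] at h2
  exact lt_of_le_of_ne h1 h2

lemma IsTree.isGate_self (hG : G.IsTree) {K : Set V} {s : V} (hs : s ∈ K) : G.IsGate K s s :=
  ⟨hs, fun _ _ hadj => by simpa using hG.1.pos_dist_of_ne hadj.ne'⟩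

/-- This is what makes gate maps monotone. If `x` is no gate for `s'`, some edge from `x` to `c`
inside `K` separates `s` from `s'`, so it is the edge from `s` to `s'` itself. -/
lemma IsTree.isGate_adj (hG : G.IsTree) {K : Set V} (hK : (G.induce K).Preconnected)
    {s s' x x' : V} (hs : G.Adj s s') (hx : G.IsGate K s x) (hx' : G.IsGate K s' x') :
    x = x' ∨ x = s ∧ x' = s' := by
  by_cases h : G.IsGate K s' x
  · exact .inl (hG.isGate_unique hK h hx')
  · obtain ⟨c, hc, hadj, hlt⟩ : ∃ c ∈ K, G.Adj x c ∧ ¬ G.dist x s' < G.dist c s' := by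
      by_contra! hcon
      exact h ⟨hx.1, hcon⟩
    have hne := hG.dist_ne_of_adj s' hadj
    simp only [G.dist_comm (u := s')] at hne
    obtain ⟨rfl, rfl⟩ := hG.eq_and_eq_of_dist_lt hadj hs (hx.2 c hc hadj) (by omega)
    exact .inr ⟨rfl, hG.isGate_unique hK hx' (hG.isGate_self hc)⟩

end SimpleGraph

namespace MonEquiv

/-! ### Weights on finite types and their gluing -/

section Weights

open scoped Classical

/-- The image of the weight `q` under the map `r`. -/
noncomputable def pushWeight {X Y : Type*} [Fintype X] (r : X → Y) (q : X → ℝ) (y : Y) : ℝ :=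
  ∑ x with r x = y, q x

/-! ### Images of weights and couplings -/

section Push

variable {X Y Z : Type*} [Fintype X]

lemma pushWeight_nonneg (r : X → Y) {q : X → ℝ} (hq : ∀ x, 0 ≤ q x) (y : Y) :
    0 ≤ pushWeight r q y :=
  Finset.sum_nonneg fun x _ => hq x

lemma le_pushWeight (r : X → Y) {q : X → ℝ} (hq : ∀ x, 0 ≤ q x) (x : X) :
    q x ≤ pushWeight r q (r x) :=
  Finset.single_le_sum (f := q) (fun x _ => hq x) (by simp)

lemma exists_of_pushWeight_ne_zero {r : X → Y} {q : X → ℝ} {y : Y} (h : pushWeight r q y ≠ 0) :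
    ∃ x, r x = y ∧ q x ≠ 0 := by
  obtain ⟨x, hx, hq⟩ := Finset.exists_ne_zero_of_sum_ne_zero h
  exact ⟨x, by simpa using hx, hq⟩

lemma sum_pushWeight_mul [Fintype Y] (r : X → Y) (q : X → ℝ) (g : Y → ℝ) :
    ∑ y, pushWeight r q y * g y = ∑ x, q x * g (r x) := by
  simp only [pushWeight, Finset.sum_mul, Finset.sum_filter]
  rw [Finset.sum_comm]
  refine Finset.sum_congr rfl fun x _ => ?_
  simp [ite_mul]

lemma sum_filter_pushWeight [Fintype Y] (r : X → Y) (q : X → ℝ) (P : Y → Prop) :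
    ∑ y with P y, pushWeight r q y = ∑ x with P (r x), q x := by
  simpa [Finset.sum_filter] using sum_pushWeight_mul r q fun y => if P y then 1 else 0

lemma sum_pushWeight [Fintype Y] (r : X → Y) (q : X → ℝ) : ∑ y, pushWeight r q y = ∑ x, q x := by
  simpa using sum_pushWeight_mul r q fun _ => 1

lemma pushWeight_comp [Fintype Y] (r : X → Y) (r' : Y → Z) (q : X → ℝ) :
    pushWeight r' (pushWeight r q) = pushWeight (r' ∘ r) q :=
  funext fun z => sum_filter_pushWeight r q fun y => r' y = z

lemma pushWeight_congr {r r' : X → Y} {q : X → ℝ} (h : ∀ x, q x ≠ 0 → r x = r' x) :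
    pushWeight r q = pushWeight r' q := by
  funext y
  simp only [pushWeight, Finset.sum_filter]
  refine Finset.sum_congr rfl fun x _ => ?_
  by_cases hx : q x = 0
  · simp [hx]
  · rw [h x hx]

/-- Two weights with the same image can be glued along it. -/
lemma exists_glue [Fintype Y] (p : X → Z) (q : Y → Z) {u : X → ℝ} {v : Y → ℝ} (hu : ∀ x, 0 ≤ u x)
    (hv : ∀ y, 0 ≤ v y) (h : pushWeight p u = pushWeight q v) :
    ∃ w : X × Y → ℝ, (∀ z, 0 ≤ w z) ∧ (∀ z, w z ≠ 0 → p z.1 = q z.2) ∧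
      pushWeight Prod.fst w = u ∧ pushWeight Prod.snd w = v := by
  -- Conditionally independent coupling on each fibre. On a fibre of mass zero the quotient is `0`,
  -- which is correct since `u` and `v` vanish there.
  refine ⟨fun z => if p z.1 = q z.2 then u z.1 * v z.2 / pushWeight p u (p z.1) else 0,
    fun z => ?_, fun z hz => ?_, funext fun x => ?_, funext fun y => ?_⟩
  · have := pushWeight_nonneg p hu (p z.1)
    have := hu z.1
    have := hv z.2
    dsimp only
    split_ifs <;> positivity
  · by_contra hne
    simp [hne] at hz
  · have e : ∀ w : X × Y → ℝ, pushWeight Prod.fst w x = ∑ y, w (x, y) := fun w => by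
      rw [pushWeight, Finset.sum_filter, Fintype.sum_prod_type, Finset.sum_comm]
      simp
    rw [e]
    have : ∀ y, (if p x = q y then u x * v y / pushWeight p u (p x) else 0) =
        u x / pushWeight p u (p x) * if q y = p x then v y else 0 := fun y => by
      by_cases hxy : p x = q y
      · rw [if_pos hxy, if_pos hxy.symm]; ring
      · rw [if_neg hxy, if_neg (Ne.symm hxy)]; ring
    simp only [this]
    rw [← Finset.mul_sum, ← Finset.sum_filter]
    change u x / pushWeight p u (p x) * pushWeight q v (p x) = u x
    rw [← h]
    by_cases h0 : pushWeight p u (p x) = 0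
    · have h1 := le_pushWeight p hu x
      have h2 : u x = 0 := le_antisymm (h0 ▸ h1) (hu x)
      simp [h2]
    · field_simp
  · have e : ∀ w : X × Y → ℝ, pushWeight Prod.snd w y = ∑ x, w (x, y) := fun w => by
      rw [pushWeight, Finset.sum_filter, Fintype.sum_prod_type]
      simp
    rw [e]
    have : ∀ x, (if p x = q y then u x * v y / pushWeight p u (p x) else 0) =
        v y / pushWeight p u (q y) * if p x = q y then u x else 0 := fun x => by
      by_cases hxy : p x = q y
      · rw [if_pos hxy, if_pos hxy, hxy]; ring
      · rw [if_neg hxy, if_neg hxy]; ring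
    simp only [this]
    rw [← Finset.mul_sum, ← Finset.sum_filter]
    change v y / pushWeight p u (q y) * pushWeight p u (q y) = v y
    by_cases h0 : pushWeight p u (q y) = 0
    · have h1 := le_pushWeight q hv y
      have h2 : v y = 0 := le_antisymm (by rw [← h, h0] at h1; exact h1) (hv y)
      simp [h2]
    · field_simp

end Push

/-! ### Weights on functions, glued along restrictions -/

section Glue

variable {A S : Type*} [Fintype A] [Fintype S]

lemma pushWeight_restrict_mono {u v : (A → S) → ℝ} {B C : Set A} (hBC : B ⊆ C)
    (h : pushWeight C.domRestrict u = pushWeight C.domRestrict v) :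
    pushWeight B.domRestrict u = pushWeight B.domRestrict v := by
  have key : ∀ w : (A → S) → ℝ, pushWeight B.domRestrict w =
      pushWeight (fun f (b : B) => f ⟨b, hBC b.2⟩) (pushWeight C.domRestrict w) := fun w => by
    rw [pushWeight_comp]
    rfl
  rw [key, key, h]

lemma pushWeight_eval_eq {u v : (A → S) → ℝ} {B : Set A} {a : A} (ha : a ∈ B)
    (h : pushWeight B.domRestrict u = pushWeight B.domRestrict v) :
    pushWeight (fun f => f a) u = pushWeight (fun f => f a) v := by
  have key : ∀ w : (A → S) → ℝ, pushWeight (fun f => f a) w =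
      pushWeight (fun f : B → S => f ⟨a, ha⟩) (pushWeight B.domRestrict w) := fun w => by
    rw [pushWeight_comp]
    rfl
  rw [key, key, h]

lemma exists_glue_restrict {u v : (A → S) → ℝ} {B C : Set A} (hu : ∀ f, 0 ≤ u f)
    (hv : ∀ f, 0 ≤ v f)
    (h : pushWeight (B ∩ C).domRestrict u = pushWeight (B ∩ C).domRestrict v) :
    ∃ w : (A → S) → ℝ, (∀ f, 0 ≤ w f) ∧ pushWeight B.domRestrict w = pushWeight B.domRestrict u ∧
      pushWeight C.domRestrict w = pushWeight C.domRestrict v := by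
  obtain ⟨w, hw, hsupp, rfl, rfl⟩ := exists_glue _ _ hu hv h
  -- The coupled pairs agree on `B ∩ C`, so the merged function restricts to the second component on
  -- all of `C`.
  refine ⟨pushWeight (fun z a => if a ∈ B then z.1 a else z.2 a) w, pushWeight_nonneg _ hw,
    ?_, ?_⟩
  · rw [pushWeight_comp, pushWeight_comp]
    refine pushWeight_congr fun z _ => funext fun a => ?_
    simp [Set.domRestrict_apply]
  · rw [pushWeight_comp, pushWeight_comp]
    refine pushWeight_congr fun z hz => funext fun a => ?_
    by_cases ha : (a : A) ∈ B
    · simpa [Set.domRestrict_apply, ha] using congrFun (hsupp z hz) ⟨a, ha, a.2⟩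
    · simp [Set.domRestrict_apply, ha]

/-- Weights indexed by the vertices of a tree, each relevant on a subset of `A`, can be glued when
neighbouring ones are consistent and the vertices to which an element of `A` is relevant are
connected. -/
lemma exists_glue_tree {D : Type*} [Finite D] {T : SimpleGraph D} (hT : T.IsTree)
    (B : D → Set A) (hB : ∀ a, (T.induce {d | a ∈ B d}).Preconnected)
    (u : D → (A → S) → ℝ) (hu : ∀ d f, 0 ≤ u d f)
    (hcons : ∀ d e, T.Adj d e →
      pushWeight (B d ∩ B e).domRestrict (u d) = pushWeight (B d ∩ B e).domRestrict (u e)) :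
    ∃ w : (A → S) → ℝ, (∀ f, 0 ≤ w f) ∧
      ∀ d, pushWeight (B d).domRestrict w = pushWeight (B d).domRestrict (u d) := by
  obtain ⟨d₀⟩ := hT.1.nonempty
  have : Fintype D := Fintype.ofFinite D
  -- The glued region `E` grows one vertex at a time and stays connected to `d₀`.
  have key : ∀ n, n + 1 ≤ Fintype.card D → ∃ E : Finset D, E.card = n + 1 ∧
      (∀ d ∈ E, ∃ p : T.Walk d d₀, ∀ e ∈ p.support, e ∈ E) ∧ ∃ w : (A → S) → ℝ,
        (∀ f, 0 ≤ w f) ∧ ∀ d ∈ E, pushWeight (B d).domRestrict w = pushWeight (B d).domRestrict (u d) := by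
    intro n
    induction n with
    | zero =>
      intro _
      refine ⟨{d₀}, rfl, ?_, u d₀, hu d₀, by simp⟩
      simp only [Finset.mem_singleton, forall_eq]
      exact ⟨.nil, by simp⟩
    | succ n ih =>
      intro hn
      obtain ⟨E, hE, hwalk, w, hw, hwE⟩ := ih (by omega)
      obtain ⟨d₁, hd₁⟩ : ∃ d, d ∉ E := by
        by_contra! hall
        rw [Finset.eq_univ_iff_forall.2 hall, Finset.card_univ] at hE
        omega
      obtain ⟨d₂, hd₂⟩ : E.Nonempty := Finset.card_pos.1 (by omega)
      obtain ⟨p⟩ := hT.1 d₂ d₁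
      obtain ⟨δ, -, hδ, hδ'⟩ := p.exists_boundary_dart (E : Set D) hd₂ hd₁
      obtain ⟨⟨b, c⟩, hbc⟩ := δ
      simp only [Finset.mem_coe] at hδ hδ' hbc
      -- The only path from `d ∈ E` to `c` runs inside `E` to `b` and then along the edge to `c`. If
      -- `a` is relevant at both ends, it is relevant along this path, in particular at `b`.
      have hinter : (⋃ d ∈ E, B d) ∩ B c ⊆ B b ∩ B c := by
        rintro a ⟨ha, hac⟩
        obtain ⟨d, hd, had⟩ := Set.mem_iUnion₂.1 ha
        refine ⟨?_, hac⟩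
        obtain ⟨q, hq, hqs⟩ := (hB a).exists_isPath_support_subset (x := d) (y := c) had hac
        obtain ⟨p₁, hp₁⟩ := hwalk d hd
        obtain ⟨p₂, hp₂⟩ := hwalk b hδ
        have hr : ∀ e ∈ (p₁.append p₂.reverse).bypass.support, e ∈ E := fun e he => by
          have := SimpleGraph.Walk.support_bypass_subset_support _ he
          rw [SimpleGraph.Walk.mem_support_append_iff, SimpleGraph.Walk.support_reverse,
            List.mem_reverse] at this
          exact this.elim (hp₁ e) (hp₂ e)
        have hpath : ((p₁.append p₂.reverse).bypass.concat hbc).IsPath :=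
          (SimpleGraph.Walk.bypass_isPath _).concat (fun hc => hδ' (hr _ hc)) _
        have := (hT.existsUnique_path d c).unique hpath hq
        apply hqs
        rw [← this]
        simp [SimpleGraph.Walk.support_concat]
      obtain ⟨w', hw', hw'E, hw'c⟩ := exists_glue_restrict (B := ⋃ d ∈ E, B d) (C := B c) hw (hu c)
        (pushWeight_restrict_mono hinter ((pushWeight_restrict_mono Set.inter_subset_left
          (hwE b hδ)).trans (hcons b c hbc)))
      refine ⟨insert c E, by rw [Finset.card_insert_of_notMem hδ', hE], ?_, w', hw', ?_⟩
      · intro d hd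
        rcases Finset.mem_insert.1 hd with rfl | hd
        · obtain ⟨p, hp⟩ := hwalk b hδ
          refine ⟨.cons hbc.symm p, fun e he => ?_⟩
          rw [SimpleGraph.Walk.support_cons, List.mem_cons] at he
          exact Finset.mem_insert.2 (he.imp_right (hp e))
        · obtain ⟨p, hp⟩ := hwalk d hd
          exact ⟨p, fun e he => Finset.mem_insert_of_mem (hp e he)⟩
      · intro d hd
        rcases Finset.mem_insert.1 hd with rfl | hd
        · exact hw'c
        · rw [← hwE d hd]
          exact pushWeight_restrict_mono (Set.subset_iUnion₂_of_subset d hd subset_rfl) hw'E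
  obtain ⟨E, hE, -, w, hw, hwE⟩ := key (Fintype.card D - 1) (by
    have : 0 < Fintype.card D := Fintype.card_pos_iff.2 ⟨d₀⟩
    omega)
  have hEu : E = Finset.univ := by
    rw [← Finset.card_eq_iff_eq_univ, hE]
    have : 0 < Fintype.card D := Fintype.card_pos_iff.2 ⟨d₀⟩
    omega
  exact ⟨w, hw, fun d => hwE d (hEu ▸ Finset.mem_univ d)⟩

end Glue

end Weights

/-! ### Realizable systems of weights -/

lemma exists_isMin_le {S : Type*} [PartialOrder S] [Finite S] (x : S) : ∃ m, IsMin m ∧ m ≤ x := by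
  obtain ⟨m, hmx, hm⟩ := (Set.toFinite (Set.univ : Set S)).exists_le_minimal (Set.mem_univ x)
  exact ⟨m, minimal_true.1 (by simpa using hm), hmx⟩

lemma exists_le_isMax {S : Type*} [PartialOrder S] [Finite S] (x : S) : ∃ y, IsMax y ∧ x ≤ y := by
  obtain ⟨y, hy, hxy⟩ := exists_isMin_le (OrderDual.toDual x)
  exact ⟨OrderDual.ofDual y, hy.ofDual, hxy⟩

section Realizable

open scoped Classical

variable {A S : Type*} [PartialOrder A] [PartialOrder S] [Fintype S]

/-- A stochastically monotone system of probability weights. -/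
structure IsMonotoneSystem (p : A → S → ℝ) : Prop where
  nonneg : ∀ a s, 0 ≤ p a s
  sum_eq_one : ∀ a, ∑ s, p a s = 1
  mono : ∀ a b, a ≤ b → ∀ U : Set S, IsUpperSet U → ∑ s with s ∈ U, p a s ≤ ∑ s with s ∈ U, p b s

/-- The system of weights `p` is the system of marginals of a weight on monotone functions. -/
def Realizable [Fintype A] (p : A → S → ℝ) : Prop :=
  ∃ w : (A → S) → ℝ, (∀ f, 0 ≤ w f) ∧ (∀ a, pushWeight (fun f => f a) w = p a) ∧
    ∀ f, w f ≠ 0 → Monotone f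

lemma IsMonotoneSystem.map {S' : Type*} [PartialOrder S'] [Fintype S'] {p : A → S → ℝ}
    (hp : IsMonotoneSystem p) {r : S → S'} (hr : Monotone r) :
    IsMonotoneSystem fun a => pushWeight r (p a) where
  nonneg a := pushWeight_nonneg r (hp.nonneg a)
  sum_eq_one a := by rw [sum_pushWeight, hp.sum_eq_one]
  mono a b hab U hU := by
    rw [sum_filter_pushWeight, sum_filter_pushWeight]
    exact hp.mono a b hab (r ⁻¹' U) (hU.preimage hr)

lemma Realizable.map [Fintype A] {S' : Type*} [PartialOrder S'] [Fintype S'] {p : A → S → ℝ}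
    (hp : Realizable p) {r : S → S'} (hr : Monotone r) :
    Realizable fun a => pushWeight r (p a) := by
  obtain ⟨w, hw, hm, hs⟩ := hp
  refine ⟨pushWeight (fun f => r ∘ f) w, pushWeight_nonneg _ hw, fun a => ?_, fun f hf => ?_⟩
  · change _ = pushWeight r (p a)
    rw [← hm a, pushWeight_comp, pushWeight_comp]
    rfl
  · obtain ⟨g, rfl, hg⟩ := exists_of_pushWeight_ne_zero hf
    exact hr.comp (hs g hg)

lemma IsMonotoneSystem.sum_lower {p : A → S → ℝ} (hp : IsMonotoneSystem p) {a b : A}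
    (hab : a ≤ b) {L : Set S} (hL : IsLowerSet L) :
    ∑ s with s ∈ L, p b s ≤ ∑ s with s ∈ L, p a s := by
  have key : ∀ a : A, ∑ s with s ∈ L, p a s = 1 - ∑ s with s ∈ Lᶜ, p a s := by
    intro a
    rw [← hp.sum_eq_one a, ← Finset.sum_filter_add_sum_filter_not Finset.univ (· ∈ L)]
    simp only [Set.mem_compl_iff, add_sub_cancel_right]
  rw [key, key]
  convert sub_le_sub_left (hp.mono a b hab _ hL.compl) 1

lemma IsMonotoneSystem.dual {p : A → S → ℝ} (hp : IsMonotoneSystem p) :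
    IsMonotoneSystem (A := Aᵒᵈ) (S := Sᵒᵈ) p where
  nonneg := hp.nonneg
  sum_eq_one := hp.sum_eq_one
  mono a b hab U hU := hp.sum_lower (a := OrderDual.ofDual b) (b := OrderDual.ofDual a) hab
    (L := OrderDual.toDual ⁻¹' U) fun _ _ hxy hx => hU (OrderDual.toDual_le_toDual.2 hxy) hx

lemma Realizable.of_dual [Fintype A] {p : A → S → ℝ} (hp : Realizable (A := Aᵒᵈ) (S := Sᵒᵈ) p) :
    Realizable p := by
  obtain ⟨w, hw, hm, hs⟩ := hp
  exact ⟨w, hw, hm, fun f hf a b hab =>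
    hs f hf (show OrderDual.toDual b ≤ OrderDual.toDual a from hab)⟩

lemma Realizable.dual [Fintype A] {p : A → S → ℝ} (hp : Realizable p) :
    Realizable (A := Aᵒᵈ) (S := Sᵒᵈ) p := by
  obtain ⟨w, hw, hm, hs⟩ := hp
  exact ⟨w, hw, hm, fun f hf a b hab => hs f hf hab⟩

/-- If the images of `p` under a family of maps `r i` are realizable, and these maps together
cover each point exactly once apart from a constant surplus at maximal points, then `p` is
realizable. -/
theorem Realizable.of_retractions [Fintype A] {I : Type*} [Fintype I] {p : A → S → ℝ}
    (hp : ∀ a s, 0 ≤ p a s) (hp1 : ∀ a, ∑ s, p a s = 1) (hA : SynchronizableLower A)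
    (r : I → S → S) (c : S → ℝ) (hc : ∀ x, ¬ IsMax x → c x = 0)
    (hr : ∀ x s, ∑ i, (if r i s = x then (1 : ℝ) else 0) = c x + if s = x then 1 else 0)
    (hreal : ∀ i, Realizable fun a => pushWeight (r i) (p a)) : Realizable p := by
  choose ν hν0 hνm hνs using hreal
  set N : (A → S) → ℝ := fun f => ∑ i, ν i f with hN
  have hN0 : ∀ f, 0 ≤ N f := fun f => Finset.sum_nonneg fun i _ => hν0 i f
  have hNs : ∀ f, N f ≠ 0 → Monotone f := fun f hf => by
    obtain ⟨i, -, hi⟩ := Finset.exists_ne_zero_of_sum_ne_zero hf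
    exact hνs i f hi
  have hNm : ∀ a x, ∑ f with f a = x, N f = c x + p a x := by
    intro a x
    calc ∑ f with f a = x, N f = ∑ i, pushWeight (fun f => f a) (ν i) x := Finset.sum_comm
      _ = ∑ i, ∑ s, p a s * (if r i s = x then 1 else 0) := by
        refine Finset.sum_congr rfl fun i _ => ?_
        rw [congrFun (hνm i a) x]
        simp [pushWeight, Finset.sum_filter]
      _ = ∑ s, p a s * (c x + if s = x then 1 else 0) := by
        rw [Finset.sum_comm]
        refine Finset.sum_congr rfl fun s _ => ?_
        rw [← hr, Finset.mul_sum]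
      _ = c x + p a x := by
        simp only [mul_add, Finset.sum_add_distrib, ← Finset.sum_mul, hp1, one_mul, mul_ite,
          mul_one, mul_zero, Finset.sum_ite_eq', Finset.mem_univ, if_true]
  -- Functions with a maximal value at `b` are discarded, and each constant function at a maximal
  -- `y` receives weight `p b y`; this removes the surplus `c`.
  set u : A → (A → S) → ℝ := fun b f =>
    if IsMax (f b) then (if f = fun _ => f b then p b (f b) else 0) else N f with hu
  have hu0 : ∀ b f, 0 ≤ u b f := fun b f => by
    simp only [hu]
    split_ifs
    exacts [hp _ _, le_rfl, hN0 f]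
  have hus : ∀ b f, u b f ≠ 0 → Monotone f := fun b f hf => by
    simp only [hu] at hf
    split_ifs at hf with h1 h2
    · rw [h2]; exact monotone_const
    · exact absurd rfl hf
    · exact hNs f hf
  have hNb : ∀ {b a : A} {f : A → S}, b ≤ a → IsMax (f b) → f a ≠ f b → N f = 0 := by
    intro b a f hba hmax hne
    by_contra h
    exact hne (hmax.eq_of_ge (hNs f h hba))
  have hum : ∀ {b a : A}, b ≤ a → ∀ x, ∑ f with f a = x, u b f = p a x := by
    intro b a hba x
    by_cases hx : IsMax x
    · have e : ∀ f ∈ Finset.univ.filter (fun f : A → S => f a = x),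
          u b f = N f - (if f b = x then N f else 0) + if f = fun _ => x then p b x else 0 := by
        intro f hf
        have hfa : f a = x := by simpa using hf
        simp only [hu]
        by_cases hfb : f b = x
        · simp [hfb, hx]
        · have hfc : f ≠ fun _ => x := fun h => hfb (by rw [h])
          rw [if_neg hfb, if_neg hfc]
          by_cases hm : IsMax (f b)
          · have hne : f a ≠ f b := fun h => hfb (h ▸ hfa)
            rw [if_pos hm, hNb hba hm hne, if_neg fun h => hne (congrFun h a)]
            simp
          · rw [if_neg hm]; ring
      rw [Finset.sum_congr rfl e, Finset.sum_add_distrib, Finset.sum_sub_distrib, hNm]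
      -- For maximal `x`, the value `x` at `b` forces the value `x` at `a` on the support of `N`, so
      -- this mass is the whole marginal at `b`.
      have e1 : ∑ f with f a = x, (if f b = x then N f else 0) = c x + p b x := by
        rw [← hNm b x, Finset.sum_filter, Finset.sum_filter]
        refine Finset.sum_congr rfl fun f _ => ?_
        by_cases hfb : f b = x
        · by_cases hfa : f a = x
          · simp [hfa, hfb]
          · rw [if_neg hfa, if_pos hfb, hNb hba (hfb ▸ hx) (hfb ▸ hfa)]
        · simp [hfb]
      have e2 : ∑ f : A → S with f a = x, (if f = (fun _ => x) then p b x else 0) = p b x := by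
        rw [Finset.sum_ite_eq']
        simp
      rw [e1, e2]
      ring
    · rw [← zero_add (p a x), ← hc x hx, ← hNm]
      refine Finset.sum_congr rfl fun f hf => ?_
      have hfa : f a = x := by simpa using hf
      simp only [hu]
      by_cases hm : IsMax (f b)
      · have hne : f a ≠ f b := fun h => hx (hfa ▸ h ▸ hm)
        rw [if_pos hm, hNb hba hm hne, if_neg fun h => hne (congrFun h a)]
      · rw [if_neg hm]
  have huN : ∀ {b : A} {C : Set A} {f : A → S}, C ⊆ Set.Ici b →
      (¬ ∃ y, IsMax y ∧ ∀ a ∈ C, f a = y) → u b f = N f := by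
    intro b C f hC hf
    simp only [hu]
    by_cases hm : IsMax (f b)
    · obtain ⟨a, ha, hne⟩ : ∃ a ∈ C, f a ≠ f b := by
        by_contra! h
        exact hf ⟨_, hm, h⟩
      rw [if_pos hm, hNb (hC ha) hm hne, if_neg fun h => hne (congrFun h a)]
    · rw [if_neg hm]
  obtain ⟨T, hT⟩ := hA
  obtain ⟨w, hw0, hw⟩ := exists_glue_tree hT.isTree (fun d => Set.Ici d.1)
    (fun a => (hT.locallyConnected a).preconnected) (fun d => u d.1) (fun d => hu0 d.1) (by
      intro d e hde
      obtain ⟨-, a, hda, hea⟩ := hT.le_interlacedGraph hde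
      set C := Set.Ici d.1 ∩ Set.Ici e.1 with hC
      have haC : a ∈ C := ⟨hda.le, hea.le⟩
      have heq : ∀ f : A → S, (¬ ∃ y, IsMax y ∧ ∀ a ∈ C, f a = y) → u d.1 f = u e.1 f :=
        fun f hf => (huN Set.inter_subset_left hf).trans (huN Set.inter_subset_right hf).symm
      have hCf : ∀ {f : A → S} {g : C → S}, C.domRestrict f = g → ∀ b : C, f b = g b :=
        fun h b => congrFun h b
      funext g
      by_cases hg : ∃ y, IsMax y ∧ ∀ b, g b = y
      · obtain ⟨y, hy, hgy⟩ := hg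
        have hiff : ∀ f : A → S, C.domRestrict f = g ↔ f a = y ∧ C.domRestrict f = g := fun f =>
          ⟨fun h => ⟨(hCf h ⟨a, haC⟩).trans (hgy _), h⟩, And.right⟩
        -- The weight at a constant maximal `g` is the marginal at `a` minus the other functions
        -- with value `y` at `a`; on those, both repaired weights equal `N`.
        have key : ∀ b : A, b ≤ a → pushWeight C.domRestrict (u b) g = p a y -
            ∑ f with f a = y ∧ ¬ C.domRestrict f = g, u b f := by
          intro b hb
          rw [← hum hb y, eq_sub_iff_add_eq]
          simp only [pushWeight, Finset.sum_filter]
          rw [← Finset.sum_add_distrib]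
          refine Finset.sum_congr rfl fun f _ => ?_
          by_cases h : C.domRestrict f = g
          · simp [h, ((hiff f).1 h).1]
          · by_cases h' : f a = y <;> simp [h, h']
        rw [key _ hda.le, key _ hea.le]
        congr 1
        refine Finset.sum_congr rfl fun f hf => heq f ?_
        simp only [Finset.mem_filter, Finset.mem_univ, true_and] at hf
        rintro ⟨z, -, hz⟩
        refine hf.2 (funext fun b => ?_)
        rw [hgy, ← hf.1, hz a haC]
        exact hz b b.2
      · refine Finset.sum_congr rfl fun f hf => heq f ?_
        rintro ⟨y, hy, hfy⟩
        exact hg ⟨y, hy, fun b => by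
          rw [← hCf (f := f) (g := g) (by simpa only [Finset.mem_filter, Finset.mem_univ, true_and] using hf) b]
          exact hfy b b.2⟩)
  have hmin : ∀ a : A, ∃ d : {b : A // IsMin b}, d.1 ≤ a := fun a => by
    obtain ⟨b, hb, hba⟩ := exists_isMin_le a
    exact ⟨⟨b, hb⟩, hba⟩
  refine ⟨w, hw0, fun a => ?_, fun f hf a a' haa' => ?_⟩
  · obtain ⟨d, hda⟩ := hmin a
    rw [pushWeight_eval_eq (B := Set.Ici d.1) hda (hw d)]
    exact funext fun x => hum hda x
  · obtain ⟨d, hda⟩ := hmin a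
    have h1 := le_pushWeight (Set.Ici d.1).domRestrict hw0 f
    rw [hw d] at h1
    obtain ⟨g, hg, hgu⟩ := exists_of_pushWeight_ne_zero
      (((hw0 f).lt_of_ne' hf).trans_le h1).ne'
    have h2 : ∀ b : Set.Ici d.1, g b = f b := fun b => congrFun hg b
    have := hus _ _ hgu haa'
    rwa [h2 ⟨a, hda⟩, h2 ⟨a', hda.trans haa'⟩] at this

end Realizable

/-! ### The inverse probability transform -/

section Quantile

open scoped Classical

variable {A K : Type*} [PartialOrder A] [Fintype A] [PartialOrder K] [Fintype K]

/-- The inverse probability transform along an injective position function `ρ`. -/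
theorem IsMonotoneSystem.realizable_of_position {p : A → K → ℝ} (hp : IsMonotoneSystem p)
    {ρ : K → ℤ} (hρ : Function.Injective ρ)
    (h₁ : ∀ x y, ρ x < ρ y → x ≤ y ∨ IsUpperSet {z | ρ z ≤ ρ x})
    (h₂ : ∀ x y, ρ x < ρ y → y ≤ x ∨ IsLowerSet {z | ρ z < ρ y}) : Realizable p := by
  set F : A → K → ℝ := fun a x => ∑ z with ρ z < ρ x, p a z with hF
  set F' : A → K → ℝ := fun a x => ∑ z with ρ z ≤ ρ x, p a z with hF'
  have hFF' : ∀ a x, F' a x = F a x + p a x := by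
    intro a x
    have : Finset.univ.filter (fun z => ρ z ≤ ρ x) =
        insert x (Finset.univ.filter fun z => ρ z < ρ x) := by
      ext z
      simp [le_iff_lt_or_eq, hρ.eq_iff, or_comm]
    simp only [hF, hF']
    rw [this, Finset.sum_insert (by simp), add_comm]
  have hlt : ∀ a x y, ρ x < ρ y → F' a x ≤ F a y := fun a x y hxy =>
    Finset.sum_le_sum_of_subset_of_nonneg
      (fun z hz => by
        simp only [Finset.mem_filter, Finset.mem_univ, true_and] at hz ⊢
        exact hz.trans_lt hxy)
      fun _ _ _ => hp.nonneg _ _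
  set J : A → K → Set ℝ := fun a x => Set.Ico (F a x) (F' a x) with hJ
  have hJdisj : ∀ a x y u, u ∈ J a x → u ∈ J a y → x = y := by
    intro a x y u hx hy
    by_contra hne
    rcases lt_or_gt_of_ne (hρ.ne hne) with h | h
    · exact (hx.2.trans_le (hlt a x y h)).not_ge hy.1
    · exact (hy.2.trans_le (hlt a y x h)).not_ge hx.1
  have hJsub : ∀ a x, J a x ⊆ Set.Ico 0 1 := by
    intro a x
    refine Set.Ico_subset_Ico (Finset.sum_nonneg fun z _ => hp.nonneg a z) ?_
    rw [← hp.sum_eq_one a]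
    exact Finset.sum_le_sum_of_subset_of_nonneg (Finset.filter_subset _ _)
      fun _ _ _ => hp.nonneg _ _
  have hJcover : ∀ a, ∀ u ∈ Set.Ico (0 : ℝ) 1, ∃ x, u ∈ J a x := by
    intro a u hu
    have hne : (Finset.univ.filter fun x => u < F' a x).Nonempty := by
      by_contra hemp
      have hall : ∀ x, F' a x ≤ u := fun x => by
        by_contra hx
        exact hemp ⟨x, by simpa using hx⟩
      have : Nonempty K := by
        by_contra hK
        rw [not_nonempty_iff] at hK
        have := hp.sum_eq_one a
        simp at this
      obtain ⟨x, -, hx⟩ := Finset.exists_max_image Finset.univ ρ Finset.univ_nonempty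
      have : F' a x = 1 := by
        rw [← hp.sum_eq_one a]
        simp only [hF']
        rw [Finset.filter_true_of_mem hx]
      exact absurd (hall x) (by rw [this]; exact hu.2.not_ge)
    obtain ⟨x, hx, hmin⟩ := Finset.exists_min_image _ ρ hne
    simp only [Finset.mem_filter, Finset.mem_univ, true_and] at hx hmin
    refine ⟨x, ?_, hx⟩
    rcases (Finset.univ.filter fun z => ρ z < ρ x).eq_empty_or_nonempty with he | he
    · simp only [hF]
      rw [he, Finset.sum_empty]
      exact hu.1
    · obtain ⟨y, hy, hmax⟩ := Finset.exists_max_image _ ρ he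
      simp only [Finset.mem_filter, Finset.mem_univ, true_and] at hy hmax
      by_contra hlt'
      refine absurd (hmin y ?_) hy.not_ge
      refine (not_le.1 hlt').trans_le (Finset.sum_le_sum_of_subset_of_nonneg (fun z hz => ?_)
        fun _ _ _ => hp.nonneg _ _)
      simp only [Finset.mem_filter, Finset.mem_univ, true_and] at hz ⊢
      exact hmax z hz
  -- For each `a` the intervals `J a x` partition `[0, 1)`; a function is weighted by the set of
  -- levels at which it is the selected one.
  refine ⟨fun f => volume.real (Set.Ico (0 : ℝ) 1 ∩ ⋂ a, J a (f a)), fun f => measureReal_nonneg,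
    fun a => funext fun x => ?_, fun f hf a b hab => ?_⟩
  · rw [pushWeight, ← measureReal_biUnion_finset
      (h := fun f _ => ((measure_mono Set.inter_subset_left).trans_lt (by simp)).ne)]
    · have : (⋃ f ∈ Finset.univ.filter (fun f : A → K => f a = x),
          Set.Ico (0 : ℝ) 1 ∩ ⋂ b, J b (f b)) = J a x := by
        ext u
        simp only [Finset.mem_filter, Finset.mem_univ, true_and, Set.mem_iUnion, Set.mem_inter_iff,
          Set.mem_iInter, exists_prop]
        constructor
        · rintro ⟨f, rfl, -, hf⟩
          exact hf a
        · intro hu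
          choose g hg using fun b => hJcover b u (hJsub a x hu)
          exact ⟨g, hJdisj a _ _ u (hg a) hu, hJsub a x hu, hg⟩
      rw [this, hJ, Real.volume_real_Ico_of_le, hFF']
      · ring
      · rw [hFF']
        linarith [hp.nonneg a x]
    · intro f _ g _ hfg
      refine Set.disjoint_left.2 fun u hu hu' => hfg (funext fun b => ?_)
      exact hJdisj b _ _ u (Set.mem_iInter.1 hu.2 b) (Set.mem_iInter.1 hu'.2 b)
    · exact fun f _ => measurableSet_Ico.inter (MeasurableSet.iInter fun b => measurableSet_Ico)
  · obtain ⟨u, hu⟩ : (Set.Ico (0 : ℝ) 1 ∩ ⋂ a, J a (f a)).Nonempty := by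
      by_contra hemp
      rw [Set.not_nonempty_iff_eq_empty] at hemp
      simp [hemp] at hf
    have ha := Set.mem_iInter.1 hu.2 a
    have hb := Set.mem_iInter.1 hu.2 b
    rcases lt_trichotomy (ρ (f a)) (ρ (f b)) with h | h | h
    · refine (h₁ _ _ h).resolve_right fun hup => ?_
      have : F' a (f a) ≤ F' b (f a) := by simpa only [Set.mem_ofPred_eq] using hp.mono a b hab _ hup
      exact (ha.2.trans_le (this.trans (hlt b _ _ h))).not_ge hb.1
    · exact (hρ h).le
    · refine (h₂ _ _ h).resolve_right fun hlow => ?_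
      have : F b (f a) ≤ F a (f a) := by simpa only [Set.mem_ofPred_eq] using hp.sum_lower hab hlow
      exact (hb.2.trans_le ((hlt b _ _ h).trans this)).not_ge ha.1

/-- Systems on a poset made of two chains issuing from its least element are realizable. -/
theorem IsMonotoneSystem.realizable_of_two_chains {p : A → K → ℝ} (hp : IsMonotoneSystem p)
    {m : K} (hm : ∀ z, m ≤ z) {L : Set K} (hmL : m ∉ L) (hL : IsUpperSet L)
    (hchain : ∀ x ∈ L, ∀ y ∈ L, x ≤ y ∨ y ≤ x) (hchain' : ∀ x ∉ L, ∀ y ∉ L, x ≤ y ∨ y ≤ x)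
    (hsep : ∀ x ∉ L, ∀ y ∈ L, x ≤ y → x = m) : Realizable p := by
  set κ : K → ℤ := fun x => (Finset.univ.filter (· < x)).card with hκ
  have hκlt : ∀ x y, x < y → κ x < κ y := fun x y hxy => by
    simp only [hκ, Nat.cast_lt]
    refine Finset.card_lt_card ⟨fun z hz => ?_, fun h => ?_⟩
    · simp only [Finset.mem_filter, Finset.mem_univ, true_and] at hz ⊢
      exact hz.trans hxy
    · simpa using h (show x ∈ Finset.univ.filter (· < y) by simpa using hxy)
  have hκle : ∀ x y, x ≤ y → κ x ≤ κ y := fun x y hxy =>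
    hxy.eq_or_lt.elim (fun h => h ▸ le_rfl) fun h => (hκlt x y h).le
  have hκ0 : ∀ x, 0 ≤ κ x := fun x => Int.natCast_nonneg _
  have hκpos : ∀ x ∈ L, 0 < κ x := fun x hx =>
    (hκ0 m).trans_lt (hκlt m x ((hm x).lt_of_ne (by rintro rfl; exact hmL hx)))
  -- The chain `L` is placed to the left of `m`, with its top farthest out, and the other chain to
  -- the right, so `m` sits at `0`. Initial segments ending in `L` are then up-sets, and those
  -- ending just before a point right of `m` are lower sets.
  set ρ : K → ℤ := fun x => if x ∈ L then - κ x else κ x with hρ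
  have hρL : ∀ x ∈ L, ρ x = - κ x := fun x hx => if_pos hx
  have hρR : ∀ x ∉ L, ρ x = κ x := fun x hx => if_neg hx
  have hL' : ∀ x, x ∈ L ↔ ρ x < 0 := fun x => by
    by_cases hx : x ∈ L
    · simp only [hx, true_iff]
      linarith [hρL x hx, hκpos x hx]
    · simp only [hx, false_iff]
      linarith [hρR x hx, hκ0 x]
  have hleL : ∀ x ∈ L, ∀ y ∈ L, κ x ≤ κ y → x ≤ y := fun x hx y hy h =>
    (hchain x hx y hy).elim id fun hyx => hyx.eq_or_lt.elim (fun e => e.ge)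
      fun hlt => absurd (hκlt y x hlt) h.not_gt
  have hleR : ∀ x ∉ L, ∀ y ∉ L, κ x ≤ κ y → x ≤ y := fun x hx y hy h =>
    (hchain' x hx y hy).elim id fun hyx => hyx.eq_or_lt.elim (fun e => e.ge)
      fun hlt => absurd (hκlt y x hlt) h.not_gt
  refine hp.realizable_of_position (ρ := ρ) (fun x y hxy => ?_) (fun x y hxy => ?_)
    fun x y hxy => ?_
  · by_cases hx : x ∈ L
    · have hy : y ∈ L := by rwa [hL', ← hxy, ← hL']
      rw [hρL x hx, hρL y hy] at hxy
      exact le_antisymm (hleL x hx y hy (by omega)) (hleL y hy x hx (by omega))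
    · have hy : y ∉ L := by rwa [hL', ← hxy, ← hL']
      rw [hρR x hx, hρR y hy] at hxy
      exact le_antisymm (hleR x hx y hy (by omega)) (hleR y hy x hx (by omega))
  · by_cases hx : x ∈ L
    · right
      intro z z' hzz' (hz : ρ z ≤ ρ x)
      have hzL : z ∈ L := (hL' z).2 (hz.trans_lt ((hL' x).1 hx))
      have hzL' := hL hzz' hzL
      change ρ z' ≤ ρ x
      have := hκle z z' hzz'
      rw [hρL z hzL, hρL x hx] at hz
      rw [hρL z' hzL', hρL x hx]
      omega
    · left
      have hx0 : ¬ ρ x < 0 := fun h => hx ((hL' x).2 h)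
      have hy : y ∉ L := fun h => hx0 (hxy.trans ((hL' y).1 h))
      rw [hρR x hx, hρR y hy] at hxy
      exact hleR x hx y hy hxy.le
  · by_cases hy : y ∈ L
    · left
      have hx : x ∈ L := (hL' x).2 (hxy.trans ((hL' y).1 hy))
      rw [hρL x hx, hρL y hy] at hxy
      exact hleL y hy x hx (by omega)
    · by_cases hym : y = m
      · exact .inl (hym ▸ hm x)
      · right
        intro z z' hzz' (hz : ρ z < ρ y)
        change ρ z' < ρ y
        by_contra hcon
        rw [not_lt] at hcon
        have hz' : z' ∉ L := fun h => by
          have h1 := (hL' z').1 h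
          have h2 := hρR y hy
          have h3 := hκ0 y
          omega
        have hyz : y ≤ z := by
          rw [hρR z' hz', hρR y hy] at hcon
          exact (hleR y hy z' hz' hcon).trans hzz'
        by_cases hzL : z ∈ L
        · exact hym (hsep y hy z hzL hyz)
        · rw [hρR z hzL, hρR y hy] at hz
          exact hz.not_ge (hκle y z hyz)

end Quantile

/-! ### The structure of posets of Class W -/

section ClassW

open scoped Classical
open SimpleGraph

variable {A S : Type*} [PartialOrder A] [PartialOrder S]

lemma exists_covBy_of_mem [Finite S] {U : Set S} {x b : S} (hxb : x ≤ b) (hx : x ∉ U)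
    (hb : b ∈ U) : ∃ p q, x ≤ p ∧ p ⋖ q ∧ q ≤ b ∧ p ∉ U ∧ q ∈ U := by
  obtain ⟨p, hp, hmax⟩ := (Set.toFinite {z | x ≤ z ∧ z ≤ b ∧ z ∉ U}).exists_maximal
    ⟨x, le_rfl, hxb, hx⟩
  have hpb : p < b := hp.2.1.lt_of_ne fun h => hp.2.2 (h ▸ hb)
  obtain ⟨q, hpq, hqb⟩ := exists_covBy_le_of_lt hpb
  refine ⟨p, q, hp.1, hpq, hqb, hp.2.2, ?_⟩
  by_contra hq
  exact hpq.lt.not_ge (hmax ⟨hp.1.trans hpq.le, hqb, hq⟩ hpq.le)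

/-- An ascending chain can leave the `x` side of the edge `c ⋖ x` only along that edge, which it
would have to descend. -/
lemma dist_lt_of_le [Finite S] (hS : (hasse S).IsTree) {c x z z' : S} (hcx : c ⋖ x) (hzz' : z ≤ z')
    (hz : (hasse S).dist x z < (hasse S).dist c z) :
    (hasse S).dist x z' < (hasse S).dist c z' := by
  by_contra hz'
  obtain ⟨p, q, -, hpq, -, hp, hq⟩ := exists_covBy_of_mem
    (U := {z | ¬ (hasse S).dist x z < (hasse S).dist c z}) hzz' (by simpa using hz) hz'
  have hne := hS.dist_ne_of_adj q (show (hasse S).Adj c x from .inl hcx)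
  simp only [(hasse S).dist_comm (u := q)] at hne
  simp only [Set.mem_ofPred_eq, not_not] at hp hq
  obtain ⟨rfl, rfl⟩ := hS.eq_and_eq_of_dist_lt (x := x) (c := c) (.inr hcx) (.inl hpq) hp
    (by omega)
  exact hcx.lt.not_gt hpq.lt

/-- In a poset whose Hasse diagram is a tree, intervals are chains. -/
lemma le_total_of_mem_Icc [Finite S] (hS : (hasse S).IsTree) {a b x y : S} (hax : a ≤ x)
    (hay : a ≤ y) (hxb : x ≤ b) (hyb : y ≤ b) : x ≤ y ∨ y ≤ x := by
  rcases eq_or_ne x y with rfl | hne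
  · exact .inl le_rfl
  have hself : ∀ {c}, (hasse S).Adj x c → (hasse S).dist x x < (hasse S).dist c x := fun hc => by
    simpa using hS.1.pos_dist_of_ne hc.ne'
  have hlt : ∀ {c z}, (hasse S).Adj x c → ¬ (hasse S).dist x z < (hasse S).dist c z →
      (hasse S).dist c z < (hasse S).dist x z := fun {c z} hc h => by
    have := hS.dist_ne_of_adj z hc
    simp only [(hasse S).dist_comm (u := z)] at this
    omega
  obtain ⟨c, hxc, hc⟩ := hS.1.exists_adj_dist_lt hne
  -- Here `c` is the neighbour of `x` towards `y`. If it lies above `x`, a chain from `a` to `y`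
  -- must cross this edge; if below, a chain from `y` to `b` must.
  rcases hxc with hcov | hcov
  · obtain ⟨p, q, -, hpq, hqy, hp, hq⟩ := exists_covBy_of_mem
      (U := {z | (hasse S).dist c z < (hasse S).dist x z}) hay
      (fun ha => (hself (.inl hcov)).not_gt (dist_lt_of_le hS hcov hax ha)) hc
    have hp' : (hasse S).dist x p < (hasse S).dist c p := by
      by_contra h
      exact hp (hlt (.inl hcov) h)
    obtain ⟨rfl, rfl⟩ := hS.eq_and_eq_of_dist_lt (.inl hcov) (.inl hpq) hp' hq
    exact .inl (hcov.le.trans hqy)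
  · obtain ⟨p, q, hyp, hpq, -, hp, hq⟩ := exists_covBy_of_mem
      (U := {z | (hasse S).dist x z < (hasse S).dist c z}) hyb hc.not_gt
      (dist_lt_of_le hS hcov hxb (hself (.inr hcov)))
    obtain ⟨rfl, rfl⟩ := hS.eq_and_eq_of_dist_lt (.inr hcov) (.inr hpq) hq (hlt (.inr hcov) hp)
    exact .inr (hyp.trans hcov.le)

lemma IsClassW.le_total_of_lt (hS : IsClassW S) {m z x y : S} (hmz : m < z) (hzx : z ≤ x)
    (hzy : z ≤ y) : x ≤ y ∨ y ≤ x := by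
  by_contra! h
  refine hS.not_hasY ⟨x, y, z, m, h, .inr ⟨hmz, hzx.lt_of_ne ?_, hzy.lt_of_ne ?_⟩⟩
  · rintro rfl; exact h.1 hzy
  · rintro rfl; exact h.2 hzx

lemma IsClassW.isMin_unique (hS : IsClassW S) {m m' x : S} (hm : IsMin m) (hm' : IsMin m')
    (hmx : m ≤ x) (hmx' : m' ≤ x) (hx : ¬ IsMax x) : m = m' := by
  by_contra hne
  have h1 : ¬ m ≤ m' := fun h => hne (hm'.eq_of_le h)
  have h2 : ¬ m' ≤ m := fun h => hne (hm.eq_of_le h).symm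
  obtain ⟨w, hxw⟩ := not_isMax_iff.1 hx
  refine hS.not_hasY ⟨m, m', x, w, ⟨h1, h2⟩, .inl ⟨hmx.lt_of_ne ?_, hmx'.lt_of_ne ?_, hxw⟩⟩
  · rintro rfl; exact h2 hmx'
  · rintro rfl; exact h1 hmx

lemma preconnected_induce_Ici [Finite S] (m : S) : ((hasse S).induce (Set.Ici m)).Preconnected := by
  have key : ∀ x : S, ∀ hx : m ≤ x,
      ((hasse S).induce (Set.Ici m)).Reachable ⟨m, le_rfl⟩ ⟨x, hx⟩ := by
    intro x
    induction x using WellFoundedLT.induction with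
    | ind x ih =>
      intro hx
      rcases hx.eq_or_lt with rfl | hlt
      · exact Reachable.refl _
      · obtain ⟨c, hmc, hcx⟩ := exists_le_covBy_of_lt hlt
        refine (ih c hcx.lt hmc).trans (Adj.reachable ?_)
        exact .inl hcx
  exact fun x y => (key x.1 x.2).symm.trans (key y.1 y.2)

/-- The retraction of a poset with connected Hasse diagram onto the up-set of `m`. -/
lemma IsClassW.exists_retraction [Fintype S] (hS : IsClassW S) :
    ∃ r : {m : S // IsMin m} → S → S, (∀ m s, m.1 ≤ r m s) ∧ (∀ m, Monotone (r m)) ∧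
      ∃ c : S → ℝ, (∀ x, ¬ IsMax x → c x = 0) ∧
        ∀ x s, ∑ m, (if r m s = x then (1 : ℝ) else 0) = c x + if s = x then 1 else 0 := by
  have hT := hS.isTree
  have hpre := fun m : S => preconnected_induce_Ici m
  choose r hr using fun (m : {m : S // IsMin m}) (s : S) =>
    hT.exists_isGate (K := Set.Ici m.1) Set.nonempty_Ici s
  have hgate : ∀ m s x, r m s = x ↔ (hasse S).IsGate (Set.Ici m.1) s x := fun m s x =>
    ⟨fun h => h ▸ hr m s, fun h => hT.isGate_unique (hpre _) (hr m s) h⟩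
  refine ⟨r, fun m s => (hr m s).1, fun m => ?_,
    fun x => (Finset.univ.filter fun m : {m : S // IsMin m} => m.1 ≤ x).card - 1,
    fun x hx => ?_, fun x s => ?_⟩
  · let _ : LocallyFiniteOrder S := Fintype.toLocallyFiniteOrder
    refine (monotone_iff_forall_covBy _).2 fun s s' hss' => ?_
    rcases hT.isGate_adj (hpre _) (.inl hss') (hr m s) (hr m s') with h | ⟨h, h'⟩
    · exact h.le
    · rw [h, h']
      exact hss'.le
  · obtain ⟨m, hm, hmx⟩ := exists_isMin_le x
    have : Finset.univ.filter (fun m : {m : S // IsMin m} => m.1 ≤ x) = {⟨m, hm⟩} := by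
      ext m'
      simp only [Finset.mem_filter, Finset.mem_univ, true_and, Finset.mem_singleton]
      refine ⟨fun h => Subtype.ext (hS.isMin_unique m'.2 hm h hmx hx), ?_⟩
      rintro rfl
      exact hmx
    simp [this]
  · rw [Finset.sum_boole]
    by_cases hsx : s = x
    · subst hsx
      have : ∀ m, r m s = s ↔ m.1 ≤ s := fun m =>
        ⟨fun h => h ▸ (hr m s).1, fun h => (hgate m s s).2 (hT.isGate_self h)⟩
      simp [this]
    · obtain ⟨c, hxc, hc⟩ := hT.1.exists_adj_dist_lt (Ne.symm hsx)
      -- The lower of `x` and its neighbour `c` towards `s` is not maximal, so a single minimal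
      -- element lies below both. Its gate for `s` is not `x`, which accounts for the `- 1`.
      obtain ⟨m, hmx, hmc, hmu⟩ : ∃ m : {m : S // IsMin m}, m.1 ≤ x ∧ m.1 ≤ c ∧
          ∀ m' : {m : S // IsMin m}, m'.1 ≤ x → m'.1 ≤ c → m' = m := by
        rcases hxc with h | h
        · obtain ⟨m, hm, hmx⟩ := exists_isMin_le x
          exact ⟨⟨m, hm⟩, hmx, hmx.trans h.le, fun m' h1 _ =>
            Subtype.ext (hS.isMin_unique m'.2 hm h1 hmx h.lt.not_isMax)⟩
        · obtain ⟨m, hm, hmc⟩ := exists_isMin_le c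
          exact ⟨⟨m, hm⟩, hmc.trans h.le, hmc, fun m' _ h1 =>
            Subtype.ext (hS.isMin_unique m'.2 hm h1 hmc h.lt.not_isMax)⟩
      have : Finset.univ.filter (fun m : {m : S // IsMin m} => r m s = x) =
          (Finset.univ.filter fun m : {m : S // IsMin m} => m.1 ≤ x).erase m := by
        ext m'
        simp only [Finset.mem_filter, Finset.mem_univ, true_and, Finset.mem_erase, hgate]
        refine ⟨fun h => ⟨?_, h.1⟩, fun h => ⟨h.2, fun d hd hxd => ?_⟩⟩
        · rintro rfl
          exact (h.2 c hmc hxc).not_gt hc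
        · by_contra hlt
          have hne := hT.dist_ne_of_adj s hxd
          simp only [(hasse S).dist_comm (u := s)] at hne
          obtain rfl := hT.eq_of_dist_lt hxc hxd hc (by omega)
          exact h.1 (hmu m' h.2 hd)
      rw [this, Finset.card_erase_of_mem (by simpa using hmx), if_neg hsx, add_zero,
        Nat.cast_sub (Finset.card_pos.2 ⟨m, by simpa using hmx⟩), Nat.cast_one]

/-- For a poset of Class W, realizability can be checked on the up-sets of minimal elements. -/
theorem IsClassW.realizable_of_Ici [Fintype A] [Fintype S] (hS : IsClassW S)
    (hA : SynchronizableLower A) {p : A → S → ℝ} (hp : IsMonotoneSystem p)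
    (h : ∀ m : S, IsMin m → ∀ q : A → Set.Ici m → ℝ, IsMonotoneSystem q → Realizable q) :
    Realizable p := by
  obtain ⟨r, hr, hrm, c, hc, hrc⟩ := hS.exists_retraction
  refine .of_retractions hp.nonneg hp.sum_eq_one hA r c hc hrc fun m => ?_
  have hρ : Monotone fun s => (⟨r m s, hr m s⟩ : Set.Ici m.1) := fun _ _ hss' => hrm m hss'
  have := (h m.1 m.2 _ (hp.map hρ)).map (Subtype.mono_coe (· ∈ Set.Ici m.1))
  simp only [pushWeight_comp] at this
  exact this

theorem IsMonotoneSystem.realizable_of_chain [Fintype A] [Fintype S] {p : A → S → ℝ}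
    (hp : IsMonotoneSystem p) {m : S} (hm : ∀ z, m ≤ z) (h : ∀ x y : S, x ≤ y ∨ y ≤ x) :
    Realizable p :=
  hp.realizable_of_two_chains hm (L := ∅) (Set.notMem_empty m) isUpperSet_empty (by simp)
    (fun x _ y _ => h x y) (by simp)

/-- In Class `W_⋆`, the up-set of an element consists of at most two chains. -/
theorem IsClassWLower.realizable_Ici [Fintype A] [Fintype S] (hS : IsClassWLower S) {m : S}
    {q : A → Set.Ici m → ℝ} (hq : IsMonotoneSystem q) : Realizable q := by
  have hm : ∀ z : Set.Ici m, ⟨m, le_rfl⟩ ≤ z := fun z => z.2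
  by_cases hch : ∀ x y : Set.Ici m, x ≤ y ∨ y ≤ x
  · exact hq.realizable_of_chain hm hch
  obtain ⟨a, b, hab, hba⟩ : ∃ a b : Set.Ici m, ¬ a ≤ b ∧ ¬ b ≤ a := by
    by_contra! hcon
    exact hch fun x y => or_iff_not_imp_left.2 (hcon x y)
  have hpos : ∀ {x y : Set.Ici m}, ¬ x ≤ y → m < x.1 := fun {x y} h =>
    lt_of_le_of_ne x.2 fun e => h (show x.1 ≤ y.1 from e ▸ y.2)
  have hup : ∀ {z x y : Set.Ici m}, m < z.1 → z ≤ x → z ≤ y → x ≤ y ∨ y ≤ x := fun hz hx hy =>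
    hS.le_total_of_lt hz hx hy
  have hicc : ∀ {x y z : Set.Ici m}, x ≤ z → y ≤ z → x ≤ y ∨ y ≤ x := fun {x y z} hx hy =>
    le_total_of_mem_Icc hS.isTree x.2 y.2 hx hy
  have ha := hpos hab
  have hb := hpos hba
  -- One chain consists of the points above `m` comparable with `a`. The remaining points other than
  -- `m` are comparable with `b`, as otherwise three incomparable points would lie above `m`.
  refine hq.realizable_of_two_chains hm (L := {x | m < x.1 ∧ (x ≤ a ∨ a ≤ x)})
    (fun h => lt_irrefl _ h.1) ?_ ?_ ?_ ?_
  · rintro x y hxy ⟨hx, hxa⟩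
    refine ⟨hx.trans_le hxy, ?_⟩
    rcases hxa with h | h
    · exact (hup hx h hxy).symm
    · exact .inr (h.trans hxy)
  · rintro x ⟨hx, hxa⟩ y ⟨hy, hya⟩
    rcases hxa with h | h <;> rcases hya with h' | h'
    · exact hicc h h'
    · exact .inl (h.trans h')
    · exact .inr (h'.trans h)
    · exact hup ha h h'
  · have key : ∀ x : Set.Ici m, m < x.1 → ¬ (x ≤ a ∨ a ≤ x) → x ≤ b ∨ b ≤ x := by
      intro x hx hxa
      by_contra hxb
      simp only [not_or] at hxa hxb
      exact hS.not_hasWUpper ⟨m, a, b, x, ha, hb, hx, ⟨hab, hba⟩, ⟨hxb.2, hxb.1⟩, ⟨hxa.2, hxa.1⟩⟩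
    intro x hx y hy
    by_cases hxm : m < x.1
    · by_cases hym : m < y.1
      · rcases key x hxm fun h => hx ⟨hxm, h⟩ with h | h <;>
          rcases key y hym fun h => hy ⟨hym, h⟩ with h' | h'
        · exact hicc h h'
        · exact .inl (h.trans h')
        · exact .inr (h'.trans h)
        · exact hup hb h h'
      · refine .inr (show y.1 ≤ x.1 from ?_)
        rw [← (y.2 : m ≤ y.1).eq_of_not_lt hym]
        exact x.2
    · refine .inl (show x.1 ≤ y.1 from ?_)
      rw [← (x.2 : m ≤ x.1).eq_of_not_lt hxm]
      exact y.2
  · rintro x hx y ⟨hy, hya⟩ hxy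
    by_contra hxm
    have hmx : m < x.1 := lt_of_le_of_ne x.2 fun e => hxm (Subtype.ext e.symm)
    refine hx ⟨hmx, ?_⟩
    rcases hya with h | h
    · exact .inl (hxy.trans h)
    · exact hicc hxy h

/-- Above an element, a poset of Class W is a bunch of chains. -/
theorem IsClassW.realizable_Ici [Fintype A] [Fintype S] (hS : IsClassW S)
    (hA : SynchronizableUpper A) {m : S} {q : A → Set.Ici m → ℝ} (hq : IsMonotoneSystem q) :
    Realizable q := by
  set K := Set.Ici m with hK
  let m₀ : K := ⟨m, le_rfl⟩
  have hm : ∀ z : K, m₀ ≤ z := fun z => z.2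
  have hlt : ∀ {z : K}, z ≠ m₀ → m < z.1 := fun {z} hz =>
    lt_of_le_of_ne z.2 fun e => hz (Subtype.ext e.symm)
  have huniq : ∀ {z y y' : K}, z ≠ m₀ → IsMax y → IsMax y' → z ≤ y → z ≤ y' → y = y' := by
    intro z y y' hz hy hy' hzy hzy'
    rcases hS.le_total_of_lt (hlt hz) hzy hzy' with h | h
    · exact hy.eq_of_le h
    · exact (hy'.eq_of_le h).symm
  -- Every point other than `m₀` lies below exactly one maximal `y`: that retraction fixes it and
  -- all others send it to `m₀`. Thus the surplus is the number of maximal elements less one, all at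
  -- `m₀`.
  let r : {y : K // IsMax y} → K → K := fun y x => if x ≤ y.1 then x else m₀
  have hr : ∀ y x, r y x ≤ y.1 := fun y x => by
    simp only [r]
    split_ifs with h
    exacts [h, hm _]
  have hrm : ∀ y, Monotone (r y) := by
    intro y x x' hxx'
    simp only [r]
    split_ifs with h1 h2 h2
    · exact hxx'
    · by_cases hx : x = m₀
      · exact hx.le
      · obtain ⟨y', hy', hxy'⟩ := exists_le_isMax x'
        exact absurd (huniq hx y.2 hy' h1 (hxx'.trans hxy') ▸ hxy') h2
    · exact hm _
    · exact le_rfl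
  refine .of_dual ?_
  refine Realizable.of_retractions (A := Aᵒᵈ) (S := Kᵒᵈ) (I := {y : K // IsMax y}) hq.nonneg
    hq.sum_eq_one hA r
    (fun x : K => if x = m₀ then (Fintype.card {y : K // IsMax y} : ℝ) - 1 else 0)
    (fun x hx => ?_) (fun x s => ?_) fun y => ?_
  · refine if_neg ?_
    rintro rfl
    exact hx fun z _ => hm z
  · change K at x s
    suffices h : ∑ y, (if r y s = x then (1 : ℝ) else 0) =
        (if x = m₀ then (Fintype.card {y : K // IsMax y} : ℝ) - 1 else 0) +
          if s = x then 1 else 0 by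
      convert h <;> exact Iff.rfl
    rw [Finset.sum_boole]
    by_cases hs : s = m₀
    · have : ∀ y, r y m₀ = m₀ := fun y => ite_self _
      by_cases hx : x = m₀
      · simp [hs, hx, this]
      · simp [hs, hx, this, Ne.symm hx]
    · obtain ⟨y, hy, hsy⟩ := exists_le_isMax s
      have hle : ∀ y' : {y : K // IsMax y}, s ≤ y'.1 ↔ y' = ⟨y, hy⟩ := fun y' =>
        ⟨fun h => Subtype.ext (huniq hs y'.2 hy h hsy), fun h => h ▸ hsy⟩
      by_cases hx : x = m₀
      · have : Finset.univ.filter (fun y' => r y' s = x) = Finset.univ.erase ⟨y, hy⟩ := by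
          ext y'
          simp only [Finset.mem_filter, Finset.mem_univ, true_and, Finset.mem_erase, and_true, r,
            hle, hx]
          split_ifs with h
          · simp [h, hs]
          · simp [h]
        rw [this, Finset.card_erase_of_mem (Finset.mem_univ _), if_pos hx, hx, if_neg hs, add_zero,
          Nat.cast_sub (Finset.card_pos.2 ⟨_, Finset.mem_univ ⟨y, hy⟩⟩), Nat.cast_one,
          Finset.card_univ]
      · rw [if_neg hx, zero_add]
        by_cases hsx : s = x
        · have : Finset.univ.filter (fun y' => r y' s = x) = {⟨y, hy⟩} := by
            ext y'
            simp only [Finset.mem_filter, Finset.mem_univ, true_and, Finset.mem_singleton, r, hle]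
            split_ifs with h
            · simp [h, hsx]
            · simp [h, Ne.symm hx]
          rw [this, if_pos hsx]
          simp
        · have : Finset.univ.filter (fun y' => r y' s = x) = ∅ := by
            ext y'
            simp only [Finset.mem_filter, Finset.mem_univ, true_and, Finset.notMem_empty, iff_false,
              r]
            split_ifs with h
            exacts [hsx, Ne.symm hx]
          rw [this, if_neg hsx]
          simp
  · have hρ : Monotone fun s => (⟨r y s, hr y s⟩ : Set.Iic y.1) := fun _ _ h => hrm y h
    have := ((hq.map hρ).realizable_of_chain (m := ⟨m₀, hm _⟩) (fun z => hm z.1)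
      fun x x' => le_total_of_mem_Icc hS.isTree x.1.2 x'.1.2 x.2 x'.2).map
        (Subtype.mono_coe (· ∈ Set.Iic y.1))
    simp only [pushWeight_comp] at this
    exact this.dual

end ClassW

/-! ### Systems of measures -/

section Measures

open scoped Classical

variable {A S : Type*} [PartialOrder A] [PartialOrder S] [MeasurableSpace S]

lemma RealizablyMonotone.stochasticallyMonotone [DiscreteMeasurableSpace S] {P : A → Measure S}
    (h : RealizablyMonotone P) : StochasticallyMonotone P := by
  obtain ⟨Ω, _, ℙ, X, -, hX, hmono⟩ := h
  intro a b hab U hU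
  rw [← (hX a).2, ← (hX b).2, Measure.map_apply (hX a).1 (.of_discrete),
    Measure.map_apply (hX b).1 (.of_discrete)]
  exact measure_mono fun ω hω => hU (hmono a b hab ω) hω

lemma StochasticallyMonotone.isMonotoneSystem [Fintype S] [DiscreteMeasurableSpace S]
    {P : A → Measure S} [∀ a, IsProbabilityMeasure (P a)] (h : StochasticallyMonotone P) :
    IsMonotoneSystem fun a s => (P a).real {s} where
  nonneg _ _ := measureReal_nonneg
  sum_eq_one a := by
    rw [sum_measureReal_singleton, Finset.coe_univ, probReal_univ]
  mono a b hab U hU := by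
    rcases hab.eq_or_lt with rfl | hab
    · exact le_rfl
    · rw [sum_measureReal_singleton, sum_measureReal_singleton]
      simp only [Finset.coe_filter, Finset.mem_univ, true_and]
      exact ENNReal.toReal_mono (measure_ne_top _ _) (h a b hab U hU)

lemma Realizable.realizablyMonotone [Fintype A] [Nonempty A] [Fintype S]
    [DiscreteMeasurableSpace S] {P : A → Measure S} [∀ a, IsProbabilityMeasure (P a)]
    (h : Realizable fun a s => (P a).real {s}) : RealizablyMonotone P := by
  obtain ⟨w, hw, hm, hs⟩ := h
  -- Indexing the monotone functions by `Fin` puts the sample space in `Type`, whatever the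
  -- universes of `A` and `S`.
  let e := Fintype.equivFin {f : A → S // Monotone f}
  let X : A → Fin (Fintype.card {f : A → S // Monotone f}) → S := fun a i => (e.symm i).1 a
  let ℙ : Measure (Fin (Fintype.card {f : A → S // Monotone f})) :=
    ∑ i, ENNReal.ofReal (w (e.symm i).1) • Measure.dirac i
  have hX : ∀ a, Measurable (X a) := fun a => .of_discrete
  have hmap : ∀ a, ℙ.map (X a) = P a := by
    intro a
    refine Measure.ext_of_singleton fun x => ?_
    rw [Measure.map_apply (hX a) .of_discrete]
    have h1 : ℙ (X a ⁻¹' {x}) = ∑ i, ENNReal.ofReal (if X a i = x then w (e.symm i).1 else 0) := by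
      simp only [ℙ, Measure.coe_finsetSum, Finset.sum_apply, Measure.smul_apply, smul_eq_mul]
      refine Finset.sum_congr rfl fun i _ => ?_
      rw [Measure.dirac_apply' _ .of_discrete]
      by_cases hi : X a i = x <;> simp [Set.indicator, hi]
    rw [h1, ← ENNReal.ofReal_sum_of_nonneg fun i _ => by split_ifs; exacts [hw _, le_rfl]]
    have h2 : ∑ i, (if X a i = x then w (e.symm i).1 else 0) = (P a).real {x} := by
      have h3 : ∀ f ∉ Finset.univ.filter (fun f : A → S => Monotone f),
          (if f a = x then w f else 0) = 0 := fun f hf => by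
        by_contra hne
        exact hf (by simpa using hs f fun h0 => hne (by simp [h0]))
      rw [← show pushWeight (fun f => f a) w x = (P a).real {x} from congrFun (hm a) x, pushWeight,
        Finset.sum_filter,
        ← Finset.sum_subset (Finset.subset_univ _) fun f _ hf => h3 f hf,
        Finset.sum_subtype _ (p := Monotone) (by simp)]
      exact Equiv.sum_comp e.symm fun g => if g.1 a = x then w g.1 else 0
    rw [h2, ofReal_measureReal]
  refine ⟨_, inferInstance, ℙ, X, ⟨?_⟩, fun a => ⟨hX a, hmap a⟩, fun a b hab i =>
    (e.symm i).2 hab.le⟩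
  -- The total mass is read off from one marginal.
  obtain ⟨a⟩ := ‹Nonempty A›
  rw [← Set.preimage_univ (f := X a), ← Measure.map_apply (hX a) .univ, hmap, measure_univ]

end Measures

/-! ### Monotonicity equivalence -/

section Main

variable {A S : Type*} [PartialOrder A] [PartialOrder S]

lemma SynchronizableLower.nonempty (hA : SynchronizableLower A) : Nonempty A :=
  let ⟨_, hT⟩ := hA
  hT.isTree.1.nonempty.map Subtype.val

lemma IsClassWUpper.dual (hS : IsClassWUpper S) : IsClassWLower Sᵒᵈ where
  isTree := SimpleGraph.hasseDualIso.isTree_iff.2 hS.isTree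
  not_hasY := fun ⟨x, y, z, w, hxy, h⟩ =>
    hS.not_hasY ⟨x.ofDual, y.ofDual, z.ofDual, w.ofDual, ⟨hxy.2, hxy.1⟩,
      h.symm.imp (fun h => ⟨h.2.1, h.2.2, h.1⟩) fun h => ⟨h.2.2, h.1, h.2.1⟩⟩
  not_hasWUpper := fun ⟨w, x, y, z, hx, hy, hz, hxy, hyz, hxz⟩ =>
    hS.not_hasWLower ⟨w.ofDual, x.ofDual, y.ofDual, z.ofDual, hx, hy, hz, ⟨hxy.2, hxy.1⟩,
      ⟨hyz.2, hyz.1⟩, ⟨hxz.2, hxz.1⟩⟩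

lemma monotonicityEquivalence_of_realizable [Fintype A] [Nonempty A] [Fintype S]
    [MeasurableSpace S] [DiscreteMeasurableSpace S]
    (h : ∀ p : A → S → ℝ, IsMonotoneSystem p → Realizable p) : MonotonicityEquivalence A S :=
  fun _ _ => ⟨fun hP => (h _ hP.isMonotoneSystem).realizablyMonotone,
    RealizablyMonotone.stochasticallyMonotone⟩

end Main

end MonEquiv

theorem mainTheorem2 {A : Type*} {S : Type*} [PartialOrder A] [Finite A] [PartialOrder S]
    [Finite S] [MeasurableSpace S] [DiscreteMeasurableSpace S] (hS : MonEquiv.IsClassW S) :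
    (MonEquiv.Synchronizable A → MonEquiv.MonotonicityEquivalence A S) ∧
    (MonEquiv.IsClassWLower S → MonEquiv.SynchronizableLower A →
      MonEquiv.MonotonicityEquivalence A S) ∧
    (MonEquiv.IsClassWUpper S → MonEquiv.SynchronizableUpper A →
      MonEquiv.MonotonicityEquivalence A S) := by
  have : Fintype A := Fintype.ofFinite A
  have : Fintype S := Fintype.ofFinite S
  refine ⟨fun hA => ?_, fun hS' hA => ?_, fun hS' hA => ?_⟩
  · have := hA.1.nonempty
    exact MonEquiv.monotonicityEquivalence_of_realizable fun p hp =>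
      hS.realizable_of_Ici hA.1 hp fun m _ q hq => hS.realizable_Ici hA.2 hq
  · have := hA.nonempty
    exact MonEquiv.monotonicityEquivalence_of_realizable fun p hp =>
      hS.realizable_of_Ici hA hp fun m _ q hq => hS'.realizable_Ici hq
  · have : Nonempty A := MonEquiv.SynchronizableLower.nonempty (A := Aᵒᵈ) hA
    exact MonEquiv.monotonicityEquivalence_of_realizable fun p hp => .of_dual <|
      hS'.dual.toIsClassW.realizable_of_Ici hA hp.dual fun m _ q hq => hS'.dual.realizable_Ici hq
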